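/- Theorem 2 (number of essentially different 3-colourings is odd). Let $n\ge 1$ and let $G$ be a $4$-regular multigraph on $3n$ vertices whose edge set (counted with multiplicity) is the union of the edges of a Hamiltonian cycle $x_1-x_2-\dots-x_{3n}-x_1$ and the edges of $n$ pairwise vertex-disjoint triangles $a_i-b_i-c_i-a_i$, $i=1,\dots,n$, which together cover all vertices. Call two proper $3$-colourings of the vertices of $G$ essentially the same if one is obtained from the other by a permutation of the three colours. Then the number of essentially different proper $3$-colourings of $G$ is odd. -/

import Mathlib

/-- The multigraph `G` is a cycle-plus-triangles graph on `3n` vertices. Its vertices can be listed as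
`x 0, …, x (3n - 1)`, and also as the corners `t (i, 0), t (i, 1), t (i, 2)` of `n` disjoint
triangles, such that the edges of `G` are exactly (each listed once, so counted with multiplicity)
the `3n` edges of the Hamiltonian cycle `x 0, x 1, …, x (3n - 1), x 0` and
the `3n` sides of the `n` triangles. (`finRotate` is the cyclic successor on `Fin (3 * n)`,
and `j + 1` is the cyclic successor on `Fin 3`.) -/
def IsCyclePlusTriangles {α β : Type*} (n : ℕ) (G : Graph α β) : Prop :=
  ∃ (x : Fin (3 * n) ≃ G.vertexSet) (t : Fin n × Fin 3 ≃ G.vertexSet)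
    (e : Fin (3 * n) ⊕ Fin n × Fin 3 ≃ G.edgeSet),
    (∀ i : Fin (3 * n), G.IsLink (e (Sum.inl i)) (x i) (x (finRotate (3 * n) i))) ∧
    (∀ (i : Fin n) (j : Fin 3), G.IsLink (e (Sum.inr (i, j))) (t (i, j)) (t (i, j + 1)))

/-- Proper colourings of the vertices of a multigraph with three colours:
the two ends of every edge get different colours. -/
def ThreeColouring {α β : Type*} (G : Graph α β) : Type _ :=
  {c : G.vertexSet → Fin 3 //
    ∀ (e : β) (x y : G.vertexSet), G.IsLink e (x : α) (y : α) → c x ≠ c y}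

/-- Two proper 3-colourings are essentially the same if one is obtained from the other by
a permutation of the three colours. -/
def colourRenaming {α β : Type*} (G : Graph α β) : Setoid (ThreeColouring G) where
  r c d := ∃ σ : Equiv.Perm (Fin 3), ∀ v, d.1 v = σ (c.1 v)
  iseqv := by
    refine ⟨fun c => ⟨1, fun v => rfl⟩, ?_, ?_⟩
    · rintro c d ⟨σ, h⟩
      exact ⟨σ⁻¹, fun v => by simp [h v]⟩
    · rintro c d f ⟨σ, h⟩ ⟨τ, k⟩
      exact ⟨τ * σ, fun v => by simp [h v, k v]⟩

/-! A proper colouring restricts to a bijection on each triangle, so it is a family of permutations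
`f i` for which the colours read along the Hamiltonian cycle form a proper cyclic word. Renaming
colours allows `f b = 1` for one fixed triangle `b`, which leaves one family per class. These
families are counted modulo 2 by removing the other triangles one at a time. The corners of a
triangle cut the cycle into arcs P, Q, R. Modulo 2, the number of ways to colour the corners is the
sum of three indicators, each for PQR with one arc reversed (`sum_perm_properCyclicWord`). Each
reversal is a cyclic word on the remaining triangles, so by induction
(`sum_properCyclicWord_eq_one`) the total is 1 + 1 + 1 = 1. -/

/-- A cyclic word of colours is properly coloured when cyclically adjacent letters differ. -/
def ProperCyclicWord (l : List (Fin 3)) : Prop :=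
  l.IsChain (· ≠ ·) ∧ ∀ x ∈ l.getLast?, ∀ y ∈ l.head?, x ≠ y

instance : DecidablePred ProperCyclicWord := fun l => by
  unfold ProperCyclicWord
  infer_instance

theorem properCyclicWord_iff_chain (l : List (Fin 3)) :
    ProperCyclicWord l ↔ (l : Cycle (Fin 3)).Chain (· ≠ ·) := by
  cases l with
  | nil => simp [ProperCyclicWord]
  | cons a l =>
    rw [Cycle.chain_coe_cons, ← List.cons_append, List.isChain_append]
    simp [ProperCyclicWord]

theorem ProperCyclicWord.congr_isRotated {l m : List (Fin 3)} (h : l ~r m) :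
    ProperCyclicWord l ↔ ProperCyclicWord m := by
  rw [properCyclicWord_iff_chain, properCyclicWord_iff_chain, Cycle.coe_eq_coe.2 h]

theorem isRotated_of_three_mem {α : Type*} {L : List α} {u v w : α} (huv : u ≠ v) (huw : u ≠ w)
    (hvw : v ≠ w) (hu : u ∈ L) (hv : v ∈ L) (hw : w ∈ L) :
    ∃ P Q R : List α, L ~r u :: (P ++ v :: (Q ++ w :: R)) ∨ L ~r u :: (P ++ w :: (Q ++ v :: R)) := by
  obtain ⟨A, B, rfl⟩ := List.append_of_mem hu
  have hrot : A ++ u :: B ~r u :: (B ++ A) := List.isRotated_append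
  have hv' : v ∈ B ++ A := by simp at hv ⊢; grind
  have hw' : w ∈ B ++ A := by simp at hw ⊢; grind
  generalize B ++ A = M at *
  obtain ⟨P, Q, rfl⟩ := List.append_of_mem hv'
  have : w ∈ P ∨ w ∈ Q := by simp at hw'; grind
  rcases this with h | h
  · obtain ⟨P, P', rfl⟩ := List.append_of_mem h
    exact ⟨P, P', Q, Or.inr (by simpa using hrot)⟩
  · obtain ⟨Q, R, rfl⟩ := List.append_of_mem h
    exact ⟨P, Q, R, Or.inl hrot⟩

/-! ### The parity identity for removing one triangle -/

theorem sum_perm_fin_three {M : Type*} [AddCommMonoid M] (h : Fin 3 → Fin 3 → Fin 3 → M) :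
    ∑ π : Equiv.Perm (Fin 3), h (π 0) (π 1) (π 2) =
      h 0 1 2 + h 0 2 1 + h 1 0 2 + h 1 2 0 + h 2 0 1 + h 2 1 0 := by
  have : (Finset.univ : Finset (Equiv.Perm (Fin 3))) =
    {1, Equiv.swap 1 2, Equiv.swap 0 1, Equiv.swap 0 1 * Equiv.swap 1 2,
      Equiv.swap 1 2 * Equiv.swap 0 1, Equiv.swap 0 2} := by decide
  rw [this]
  repeat rw [Finset.sum_insert (by decide)]
  rw [Finset.sum_singleton]
  simp only [add_assoc]
  rfl

/-- Only the end letters of the arcs matter, so this is a finite check. It fails when all arcs are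
empty (6 against 3), and it relies on one-letter words counting as improper. -/
theorem sum_perm_properCyclicWord (p q r : List (Fin 3)) (hne : p ++ q ++ r ≠ []) :
    ∑ π : Equiv.Perm (Fin 3),
      (if ProperCyclicWord (π 0 :: (p ++ π 1 :: (q ++ π 2 :: r))) then (1 : ZMod 2) else 0) =
    (if ProperCyclicWord (p.reverse ++ q ++ r) then 1 else 0) +
    (if ProperCyclicWord (p ++ q.reverse ++ r) then 1 else 0) +
    (if ProperCyclicWord (p ++ q ++ r.reverse) then 1 else 0) := by
  rw [sum_perm_fin_three (fun x y z =>
    if ProperCyclicWord (x :: (p ++ y :: (q ++ z :: r))) then (1 : ZMod 2) else 0)]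
  have hrev : ∀ l : List (Fin 3), l.reverse.IsChain (· ≠ ·) ↔ l.IsChain (· ≠ ·) := by
    intro l
    rw [List.isChain_reverse]
    simp [ne_comm]
  -- An improper arc makes every term on both sides vanish, reversed or not.
  by_cases hp : p.IsChain (· ≠ ·)
  swap
  · simp [ProperCyclicWord, List.isChain_cons, List.isChain_append, hp, hrev]
  by_cases hq : q.IsChain (· ≠ ·)
  swap
  · simp [ProperCyclicWord, List.isChain_cons, List.isChain_append, hq, hrev]
  by_cases hr : r.IsChain (· ≠ ·)
  swap
  · simp [ProperCyclicWord, List.isChain_cons, List.isChain_append, hr, hrev]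
  have hends : ∀ l : List (Fin 3), l = [] ∨ ∃ s t, l.head? = some s ∧ l.getLast? = some t := by
    intro l
    rcases eq_or_ne l [] with h | h
    · exact Or.inl h
    · exact Or.inr ⟨_, _, List.head?_eq_some_head h, List.getLast?_eq_some_getLast h⟩
  -- What remains involves at most six end letters in `Fin 3`.
  rcases hends p with rfl | ⟨s₁, t₁, hs₁, ht₁⟩ <;> rcases hends q with rfl | ⟨s₂, t₂, hs₂, ht₂⟩ <;>
    rcases hends r with rfl | ⟨s₃, t₃, hs₃, ht₃⟩
  · simp at hne
  all_goals
    simp only [ProperCyclicWord, List.isChain_cons, List.isChain_append, *,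
      List.head?_append, List.getLast?_append, List.getLast?_cons, List.head?_cons,
      List.head?_reverse, List.getLast?_reverse, List.nil_append, List.append_nil, List.reverse_nil,
      List.head?_nil, List.getLast?_nil,       Option.or_some, Option.getD_some, Option.getD_none,
      forall_eq', Option.mem_def, reduceCtorEq, false_imp_iff, implies_true, true_and, and_true,
      Option.some.injEq]
    clear hne hp hq hr hrev hends
    clear * -
    decide +kernel +revert

/-! ### Induction on the triangles -/

/-- The colours along `L` when the corners of triangle `i` are coloured by the permutation `f i`. -/
def colourWord {ι : Type*} (f : ι → Equiv.Perm (Fin 3)) (L : List (ι × Fin 3)) : List (Fin 3) :=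
  L.map fun v => f v.1 v.2

theorem colourWord_update {ι : Type*} [DecidableEq ι] (f : ι → Equiv.Perm (Fin 3)) (a : ι)
    (π : Equiv.Perm (Fin 3)) {L : List (ι × Fin 3)} (h : ∀ v ∈ L, v.1 ≠ a) :
    colourWord (Function.update f a π) L = colourWord f L :=
  List.map_congr_left fun v hv => by rw [Function.update_of_ne (h v hv)]

theorem sum_update_properCyclicWord {ι : Type*} [DecidableEq ι] (f : ι → Equiv.Perm (Fin 3))
    (a : ι) {i j k : Fin 3} (hij : i ≠ j) (hik : i ≠ k) (hjk : j ≠ k) {P Q R : List (ι × Fin 3)}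
    (hP : ∀ v ∈ P, v.1 ≠ a) (hQ : ∀ v ∈ Q, v.1 ≠ a) (hR : ∀ v ∈ R, v.1 ≠ a)
    (hne : P ++ Q ++ R ≠ []) :
    ∑ π : Equiv.Perm (Fin 3), (if ProperCyclicWord (colourWord (Function.update f a π)
        ((a, i) :: (P ++ (a, j) :: (Q ++ (a, k) :: R)))) then (1 : ZMod 2) else 0) =
    (if ProperCyclicWord (colourWord f (P.reverse ++ Q ++ R)) then 1 else 0) +
    (if ProperCyclicWord (colourWord f (P ++ Q.reverse ++ R)) then 1 else 0) +
    (if ProperCyclicWord (colourWord f (P ++ Q ++ R.reverse)) then 1 else 0) := by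
  obtain ⟨ρ, rfl, rfl, rfl⟩ : ∃ ρ : Equiv.Perm (Fin 3), ρ 0 = i ∧ ρ 1 = j ∧ ρ 2 = k := by
    revert i j k
    decide
  have key := sum_perm_properCyclicWord (colourWord f P) (colourWord f Q) (colourWord f R)
    (by simpa [colourWord] using hne)
  -- Precomposing with `ρ` matches the order in which the corners occur along the cycle.
  rw [← Equiv.sum_comp (Equiv.mulRight ρ)] at key
  have h (π : Equiv.Perm (Fin 3)) : colourWord (Function.update f a π)
      ((a, ρ 0) :: (P ++ (a, ρ 1) :: (Q ++ (a, ρ 2) :: R))) =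
      π (ρ 0) :: (colourWord f P ++ π (ρ 1) :: (colourWord f Q ++ π (ρ 2) :: colourWord f R)) := by
    rw [← colourWord_update f a π hP, ← colourWord_update f a π hQ, ← colourWord_update f a π hR]
    simp [colourWord]
  have happ (M N : List (ι × Fin 3)) : colourWord f (M ++ N) = colourWord f M ++ colourWord f N :=
    List.map_append
  have hrev (M : List (ι × Fin 3)) : colourWord f M.reverse = (colourWord f M).reverse :=
    List.map_reverse
  rw [happ, happ, hrev, happ, happ, hrev, happ, happ, hrev]
  refine Eq.trans (Finset.sum_congr rfl fun π _ => ?_) key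
  rw [h]
  rfl

/-- Choices of a colouring permutation for each triangle that are trivial outside `s`. -/
def permsSupportedOn {ι : Type*} [Fintype ι] [DecidableEq ι] (s : Finset ι) :
    Finset (ι → Equiv.Perm (Fin 3)) :=
  Finset.univ.filter fun f => ∀ i ∉ s, f i = 1

theorem sum_permsSupportedOn_insert {ι M : Type*} [Fintype ι] [DecidableEq ι] [AddCommMonoid M]
    {s : Finset ι} {a : ι} (ha : a ∉ s) (g : (ι → Equiv.Perm (Fin 3)) → M) :
    ∑ f ∈ permsSupportedOn (insert a s), g f =
      ∑ f ∈ permsSupportedOn s, ∑ π : Equiv.Perm (Fin 3), g (Function.update f a π) := by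
  rw [← Finset.sum_product']
  refine Finset.sum_bij' (fun f _ => (Function.update f a 1, f a))
    (fun p _ => Function.update p.1 a p.2) ?_ ?_ ?_ ?_ ?_
  · intro f hf
    simp only [permsSupportedOn, Finset.mem_filter_univ, Finset.mem_product, Finset.mem_univ,
      and_true] at hf ⊢
    intro i hi
    by_cases h : i = a
    · simp [h]
    · simpa [h] using hf i (by simp [h, hi])
  · intro p hp
    simp only [permsSupportedOn, Finset.mem_filter_univ, Finset.mem_product, Finset.mem_univ,
      and_true] at hp ⊢
    intro i hi
    simp only [Finset.mem_insert, not_or] at hi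
    simpa [hi.1] using hp i hi.2
  · intro f _
    simp
  · intro p hp
    simp only [permsSupportedOn, Finset.mem_filter_univ, Finset.mem_product, Finset.mem_univ,
      and_true] at hp
    ext1
    · simp [← hp a ha]
    · simp
  · intro f _
    simp

/-- With the colours of triangle `b` fixed, the number of proper colourings is odd. -/
theorem sum_properCyclicWord_eq_one {ι : Type*} [Fintype ι] [DecidableEq ι] (b : ι) (s : Finset ι)
    (hb : b ∉ s) (L : List (ι × Fin 3)) (hL : L.Nodup) (hmem : ∀ v, v ∈ L ↔ v.1 ∈ insert b s) :
    ∑ f ∈ permsSupportedOn s,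
      (if ProperCyclicWord (colourWord f L) then (1 : ZMod 2) else 0) = 1 := by
  -- `L` must vary, since reversing an arc changes the cyclic order.
  induction s using Finset.induction_on generalizing L with
  | empty =>
    have hs : permsSupportedOn (∅ : Finset ι) = {1} := by
      ext f
      simp [permsSupportedOn, funext_iff]
    have h3 (i : Fin 3) : (b, i) ∈ L := by simp [hmem]
    have hperm : L.Perm [(b, 0), (b, 1), (b, 2)] := by
      refine (List.perm_ext_iff_of_nodup hL (by simp)).2 ?_
      rintro ⟨i, j⟩
      have : j = 0 ∨ j = 1 ∨ j = 2 := by fin_cases j <;> simp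
      simp [hmem]
      tauto
    have hc : (colourWord (1 : ι → Equiv.Perm (Fin 3)) L).Perm [0, 1, 2] := by
      simpa [colourWord] using hperm.map (fun v => (1 : ι → Equiv.Perm (Fin 3)) v.1 v.2)
    obtain ⟨x, y, z, hxyz⟩ := List.length_eq_three.1 hc.length_eq
    have hnd : [x, y, z].Nodup := hxyz ▸ hc.nodup_iff.2 (by decide)
    have : ∀ x y z : Fin 3, [x, y, z].Nodup → ProperCyclicWord [x, y, z] := by decide
    rw [hs, Finset.sum_singleton, hxyz, if_pos (this x y z hnd)]
  | insert a s ha ih =>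
    have hba : b ≠ a := fun h => hb (by simp [h])
    have hbs : b ∉ s := fun h => hb (by simp [h])
    obtain ⟨i, j, k, hij, hik, hjk, P, Q, R, hrot⟩ : ∃ i j k : Fin 3, i ≠ j ∧ i ≠ k ∧ j ≠ k ∧
        ∃ P Q R, L ~r (a, i) :: (P ++ (a, j) :: (Q ++ (a, k) :: R)) := by
      have h3 (i : Fin 3) : (a, i) ∈ L := by simp [hmem]
      obtain ⟨P, Q, R, h | h⟩ := isRotated_of_three_mem (by simp) (by simp) (by simp)
        (h3 0) (h3 1) (h3 2)
      · exact ⟨0, 1, 2, by decide, by decide, by decide, P, Q, R, h⟩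
      · exact ⟨0, 2, 1, by decide, by decide, by decide, P, Q, R, h⟩
    have hnd := hrot.perm.nodup_iff.1 hL
    have hall (x : Fin 3) : x = i ∨ x = j ∨ x = k := by
      clear * - hij hik hjk
      decide +revert
    have hmem' (v) := hrot.perm.mem_iff.symm.trans (hmem v)
    have hna : ∀ v ∈ P ++ Q ++ R, v.1 ≠ a := by
      rintro ⟨c, x⟩ hv rfl
      rcases hall x with rfl | rfl | rfl <;> simp [List.nodup_append] at hnd hv <;> grind
    have hcover (v) : v ∈ P ++ Q ++ R ↔ v.1 ∈ insert b s := by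
      constructor
      · intro hv
        have h1 := (hmem' v).1 (by simp at hv ⊢; tauto)
        have h2 := hna v hv
        simp at h1 ⊢
        tauto
      · intro hv
        have hva : v.1 ≠ a := by
          rintro h
          rw [h] at hv
          simp [ha, hba.symm] at hv
        have h1 := (hmem' v).2 (by simp at hv ⊢; tauto)
        obtain ⟨c, x⟩ := v
        simp at h1 hva ⊢
        tauto
    have hnd' : (P ++ Q ++ R).Nodup := by
      simp [List.nodup_append] at hnd ⊢
      grind
    have hstep (M : List (ι × Fin 3)) (hM : M.Perm (P ++ Q ++ R)) :=
      ih hbs M (hM.nodup_iff.2 hnd') (fun v => hM.mem_iff.trans (hcover v))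
    -- Triangle `b` is never removed, so the arcs are not all empty.
    have hne : P ++ Q ++ R ≠ [] := List.ne_nil_of_mem ((hcover (b, 0)).2 (by simp))
    rw [sum_permsSupportedOn_insert ha]
    have hrot' (f : ι → Equiv.Perm (Fin 3)) : ProperCyclicWord (colourWord f L) ↔
        ProperCyclicWord (colourWord f ((a, i) :: (P ++ (a, j) :: (Q ++ (a, k) :: R)))) :=
      ProperCyclicWord.congr_isRotated (hrot.map _)
    rw [Finset.sum_congr rfl fun f _ =>
      (Finset.sum_congr rfl fun π _ => if_congr (hrot' _) rfl rfl).trans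
        (sum_update_properCyclicWord f a hij hik hjk (fun v hv => hna v (by simp [hv]))
          (fun v hv => hna v (by simp [hv])) (fun v hv => hna v (by simp [hv])) hne)]
    rw [Finset.sum_add_distrib, Finset.sum_add_distrib,
      hstep _ (((List.reverse_perm P).append_right Q).append_right R),
      hstep _ (((List.reverse_perm Q).append_left P).append_right R),
      hstep _ ((List.reverse_perm R).append_left (P ++ Q))]
    decide

/-! ### From colourings of the graph to cyclic words -/

theorem properCyclicWord_ofFn {m : ℕ} (g : Fin m → Fin 3) :
    ProperCyclicWord (List.ofFn g) ↔ ∀ i, g i ≠ g (finRotate m i) := by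
  cases m with
  | zero => simp [ProperCyclicWord]
  | succ m =>
    rw [ProperCyclicWord, List.isChain_iff_getElem]
    have h0 : (List.ofFn g).head? = some (g 0) := by simp
    have h1 : (List.ofFn g).getLast? = some (g (Fin.last m)) := by
      rw [List.getLast?_eq_getElem?, List.length_ofFn, Nat.add_sub_cancel,
        List.getElem?_eq_getElem (by simp), List.getElem_ofFn]
      rfl
    simp only [h0, h1, Option.mem_some, forall_eq']
    rw [Fin.forall_fin_succ' (P := fun i => g i ≠ g (finRotate (m + 1) i)), finRotate_last]
    simp only [List.getElem_ofFn, List.length_ofFn, finRotate_apply, Fin.coeSucc_eq_succ, Fin.forall_iff, Nat.add_lt_add_iff_right]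
    rfl

theorem theorem2 {α β : Type*} (n : ℕ) (hn : 1 ≤ n) (G : Graph α β)
    (hG : IsCyclePlusTriangles n G) :
    Odd (Nat.card (Quotient (colourRenaming G))) := by
  obtain ⟨x, t, e, hcyc, htri⟩ := hG
  let b : Fin n := ⟨0, hn⟩
  let L : List (Fin n × Fin 3) := List.ofFn fun i => t.symm (x i)
  -- Triangle sides impose nothing, as each `f i` is injective; only cycle edges constrain `f`.
  have hproper (f : Fin n → Equiv.Perm (Fin 3)) : ProperCyclicWord (colourWord f L) ↔
      ∀ (e' : β) (u v : G.vertexSet), G.IsLink e' (u : α) (v : α) →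
        f (t.symm u).1 (t.symm u).2 ≠ f (t.symm v).1 (t.symm v).2 := by
    have hword : colourWord f L = List.ofFn fun i => f (t.symm (x i)).1 (t.symm (x i)).2 := by
      simp [colourWord, L, List.map_ofFn, Function.comp_def]
    rw [hword, properCyclicWord_ofFn]
    constructor
    · intro h e' u v huv
      have hlink {u' v' : G.vertexSet} (hl : G.IsLink e' u' v')
          (hne : f (t.symm u').1 (t.symm u').2 ≠ f (t.symm v').1 (t.symm v').2) :
          f (t.symm u).1 (t.symm u).2 ≠ f (t.symm v).1 (t.symm v).2 := by
        rcases huv.eq_and_eq_or_eq_and_eq hl with ⟨h1, h2⟩ | ⟨h1, h2⟩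
        · rwa [Subtype.ext h1, Subtype.ext h2]
        · rw [Subtype.ext h1, Subtype.ext h2]
          exact hne.symm
      obtain ⟨y, hy⟩ := e.surjective ⟨e', huv.edge_mem⟩
      rcases y with i | ⟨i, j⟩
      · exact hlink (by simpa [hy] using hcyc i) (h i)
      · refine hlink (by simpa [hy] using htri i j) ?_
        simp
    · exact fun h i => h _ _ _ (hcyc i)
  let C := {f : Fin n → Equiv.Perm (Fin 3) // f b = 1 ∧ ProperCyclicWord (colourWord f L)}
  let colouring (f : C) : ThreeColouring G :=
    ⟨fun v => f.1 (t.symm v).1 (t.symm v).2, (hproper f.1).1 f.2.2⟩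
  have hbij : Function.Bijective fun f : C => (Quotient.mk (colourRenaming G) (colouring f)) := by
    constructor
    · intro f g hfg
      obtain ⟨σ, hσ⟩ := Quotient.exact hfg
      have hσ' (i : Fin n) (j : Fin 3) : g.1 i j = σ (f.1 i j) := by
        simpa [colouring] using hσ (t (i, j))
      have h1 : σ = 1 := by
        ext j
        have := hσ' b j
        rw [f.2.1, g.2.1] at this
        simpa using congrArg Fin.val this.symm
      ext i j
      simp [hσ' i j, h1]
    · intro q
      induction q using Quotient.inductionOn with | h c => ?_
      have hinj (i : Fin n) : Function.Injective fun j => c.1 (t (i, j)) := by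
        have h (j) := c.2 _ _ _ (htri i j)
        have h0 := h 0
        have h1 := h 1
        have h2 := h 2
        intro j k hjk
        fin_cases j <;> fin_cases k <;> simp_all
      let p (i : Fin n) : Equiv.Perm (Fin 3) :=
        Equiv.ofBijective _ (Finite.injective_iff_bijective.1 (hinj i))
      have hp (v) : p (t.symm v).1 (t.symm v).2 = c.1 v := by simp [p]
      -- Renaming colours by `(p b)⁻¹` makes the permutation on triangle `b` trivial.
      refine ⟨⟨fun i => (p b)⁻¹ * p i, by simp, (hproper _).2 fun e' u v huv => ?_⟩,
        Quotient.sound ⟨p b, fun v => ?_⟩⟩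
      · simpa [hp] using c.2 e' u v huv
      · simp [colouring, hp]
  rw [← Nat.card_congr (Equiv.ofBijective _ hbij), ← ZMod.natCast_eq_one_iff_odd,
    ← sum_properCyclicWord_eq_one b (Finset.univ.erase b) (by simp) L
      (List.nodup_ofFn.2 (t.symm.injective.comp x.injective)) ?_, Finset.sum_boole]
  · congr 1
    rw [Nat.card_eq_fintype_card, Fintype.card_subtype]
    congr 1
    ext f
    simp [permsSupportedOn]
  · intro v
    simp only [L, List.mem_ofFn]
    simpa [em] using ⟨x.symm (t v), by simp⟩
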